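/- Let $m>1$ be an odd integer and let $$H_m=\langle x,y\mid \underbrace{xyxy\cdots yx}_{\text{length }m}=\underbrace{yxyx\cdots xy}_{\text{length }m}\rangle .$$ For a group $G$ let $R(G)$ be the set of homomorphisms $\rho:G\to SL(2,\mathbb{C})$, for $g\in G$ let $\tau_g:R(G)\to\mathbb{C}$, $\tau_g(\rho)=\operatorname{tr}\rho(g)$, and let $T$ be the ring of functions on $R(G)$ generated by all $\tau_g$, $g\in G$. If $\gamma_1,\dots,\gamma_\nu\in G$ are such that $\tau_{\gamma_1},\dots,\tau_{\gamma_\nu}$ generate the ring $T$, the character variety of $G$ in the coordinates $\tau_{\gamma_1},\dots,\tau_{\gamma_\nu}$ (which up to canonical isomorphism does not depend on the choice of the $\gamma_i$) is $$X(G)=\{(\tau_{\gamma_1}(\rho),\dots,\tau_{\gamma_\nu}(\rho)) : \rho\in R(G)\}\subseteq\mathbb{C}^\nu .$$ Define polynomials by $p_0(T)=1$, $p_1(T)=T$, $p_2(T)=T^2-2$, $p_n(T)=T\,p_{n-1}(T)-p_{n-2}(T)$ for $n\ge 3$, and for $s\ge 1$ $$f_s(X,Z)=p_s(Z)\,(X^2-Z-1)+\sum_{i=1}^{s}(-1)^i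 p_{s-i}(Z)\,\alpha_i(X,Z),$$ where $\alpha_i(X,Z)=X^2-Z$ if $i$ is even and $\alpha_i(X,Z)=X^2-2$ if $i$ is odd. Then, for $G=H_m$: (1) $\tau_x,\tau_y,\tau_{xy}$ generate $T$, and in the coordinates $(X,Y,Z)=(\tau_x,\tau_y,\tau_{xy})$ $$X(H_m)=\{(X,Y,Z)\in\mathbb{C}^3 : Y=X,\ f_{\frac{m-1}{2}}(X,Z)=0\};$$ (2) already $\tau_x,\tau_{xy}$ generate $T$, and in the coordinates $(X,Z)=(\tau_x,\tau_{xy})$ $$X(H_m)=\{(X,Z)\in\mathbb{C}^2 : f_{\frac{m-1}{2}}(X,Z)=0\}.$$ -/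

import Mathlib

namespace TorusKnot

noncomputable section

/-- The alternating product `a * b * a * ⋯` with `n` factors, starting with `a`. -/
def altWord {G : Type*} [Monoid G] (a b : G) : ℕ → G
  | 0 => 1
  | n + 1 => a * altWord b a n

/-- The defining relators of `H m`: generators are indexed by `Fin 2`, `x` being the
generator of index `0` and `y` the one of index `1`. -/
def relators (m : ℕ) : Set (FreeGroup (Fin 2)) :=
  {altWord (FreeGroup.of 0) (FreeGroup.of 1) m *
    (altWord (FreeGroup.of 1) (FreeGroup.of 0) m)⁻¹}

/-- The group `⟨x, y | xyx⋯ = yxy⋯⟩`, both sides being alternating words of length `m`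
(for odd `m` they end in `x` and in `y` respectively). -/
abbrev H (m : ℕ) : Type := PresentedGroup (relators m)

/-- The generator `x` of `H m`. -/
def x (m : ℕ) : H m := PresentedGroup.of 0

/-- The generator `y` of `H m`. -/
def y (m : ℕ) : H m := PresentedGroup.of 1

/-- The representations of `G` in `SL(2, ℂ)`. -/
abbrev Rep (G : Type*) [Group G] : Type _ := G →* Matrix.SpecialLinearGroup (Fin 2) ℂ

/-- The trace function `τ_g : R(G) → ℂ`, `τ_g(ρ) = tr ρ(g)`. -/
def τ {G : Type*} [Group G] (g : G) : Rep G → ℂ :=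
  fun ρ => (ρ g : Matrix (Fin 2) (Fin 2) ℂ).trace

/-- The ring `T` of functions on `R(G)` generated by all the trace functions. -/
def traceRing (G : Type*) [Group G] : Subring (Rep G → ℂ) :=
  Subring.closure (Set.range (τ (G := G)))

/-- The trace functions of the elements `γ i` generate the ring `T`, so that the `γ i` can be
used as coordinates in the construction of the character variety. -/
def GeneratesTraceRing {G : Type*} [Group G] {ν : ℕ} (γ : Fin ν → G) : Prop :=
  Subring.closure (Set.range fun i => τ (γ i)) = traceRing G

/-- The character variety `X(G) = t(R(G)) ⊆ ℂ^ν`, where `t(ρ) = (τ_{γ 0}(ρ), τ_{γ 1}(ρ), …)`.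
It depends, up to canonical isomorphism, only on `G` when `GeneratesTraceRing γ` holds. -/
def characterVariety {G : Type*} [Group G] {ν : ℕ} (γ : Fin ν → G) : Set (Fin ν → ℂ) :=
  Set.range fun (ρ : Rep G) (i : Fin ν) => τ (γ i) ρ

/-- The polynomials `p_0 = 1`, `p_1 = T`, `p_2 = T² - 2`, `p_n = T p_{n-1} - p_{n-2}` for
`n ≥ 3`. -/
def p : ℕ → Polynomial ℂ
  | 0 => 1
  | 1 => Polynomial.X
  | 2 => Polynomial.X ^ 2 - 2
  | n + 3 => Polynomial.X * p (n + 2) - p (n + 1)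

/-- The polynomial `p_s(Z)` in the two variables `X` (index `0`) and `Z` (index `1`). -/
def pZ (s : ℕ) : MvPolynomial (Fin 2) ℂ := Polynomial.aeval (MvPolynomial.X 1) (p s)

/-- `h(X, Z) = X² - Z`. -/
def h : MvPolynomial (Fin 2) ℂ := MvPolynomial.X 0 ^ 2 - MvPolynomial.X 1

/-- `k(X) = X² - 2`. -/
def k : MvPolynomial (Fin 2) ℂ := MvPolynomial.X 0 ^ 2 - 2

/-- `α_l` is `h` for even `l` and `k` for odd `l`. -/
def α (l : ℕ) : MvPolynomial (Fin 2) ℂ := if Even l then h else k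

/-- `f_s(X, Z) = p_s(Z) (h(X, Z) - 1) + ∑_{i=1}^s (-1)^i p_{s-i}(Z) α_i(X, Z)`. -/
def f (s : ℕ) : MvPolynomial (Fin 2) ℂ :=
  pZ s * (h - 1) + ∑ i ∈ Finset.Icc 1 s, (-1) ^ i * pZ (s - i) * α i

end

end TorusKnot

namespace TorusKnot

open Polynomial Matrix

/-! ### Alternating words and the defining relation -/

/-! Write `m = 2s + 1`. The relation becomes `(xy)^s x = y (xy)^s`, so `y` is conjugate to `x` and
`τ_y = τ_x`. For `A`, `B` in `SL(2)` of equal trace and `z = tr AB`, Cayley–Hamilton gives `(AB)^s A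
- B (AB)^s = (S_s(z) - S_{s-1}(z)) (A - B)` with Chebyshev polynomials `S` (`pow_mul_sub_mul_pow`).
Hence the relation holds iff the scalar vanishes or `A = B`; the latter forces `z = t² - 2`, where
`t = tr A`. These two cases are the factors of `f_s` (`eval_f_succ`), and every `(t, z)` comes from
some pair `A`, `B`.

Generation of `T` is Fricke's argument: words in `a`, `b` are combinations of `1, a, b, ab` with
coefficients polynomial in `τ_a, τ_b, τ_{ab}`. -/

theorem altWord_two_mul_add_one {G : Type*} [Monoid G] (a b : G) (s : ℕ) :
    altWord a b (2 * s + 1) = (a * b) ^ s * a := by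
  induction s with
  | zero => simp [altWord]
  | succ s ih =>
    rw [show 2 * (s + 1) + 1 = 2 * s + 1 + 1 + 1 by ring, altWord, altWord, ih, pow_succ']
    simp only [mul_assoc]

theorem map_altWord {G K : Type*} [Monoid G] [Monoid K] (φ : G →* K) (a b : G) (n : ℕ) :
    φ (altWord a b n) = altWord (φ a) (φ b) n := by
  induction n generalizing a b with
  | zero => simp [altWord]
  | succ n ih => simp [altWord, ih]

theorem mul_pow_mul_eq_mul_mul_pow {G : Type*} [Monoid G] (a b : G) (s : ℕ) :
    (b * a) ^ s * b = b * (a * b) ^ s := by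
  induction s with
  | zero => simp
  | succ s ih => rw [pow_succ', mul_assoc, ih, pow_succ']; simp only [mul_assoc]

theorem altWord_x_y (m : ℕ) : altWord (x m) (y m) m = altWord (y m) (x m) m := by
  have hmk : PresentedGroup.mk (relators m) (altWord (FreeGroup.of 0) (FreeGroup.of 1) m *
      (altWord (FreeGroup.of 1) (FreeGroup.of 0) m)⁻¹) = 1 :=
    PresentedGroup.one_of_mem rfl
  rw [map_mul, map_inv, mul_inv_eq_one, map_altWord, map_altWord] at hmk
  exact hmk

theorem xy_pow_mul_x (s : ℕ) :
    (x (2 * s + 1) * y (2 * s + 1)) ^ s * x (2 * s + 1) =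
      y (2 * s + 1) * (x (2 * s + 1) * y (2 * s + 1)) ^ s := by
  rw [← mul_pow_mul_eq_mul_mul_pow, ← altWord_two_mul_add_one, ← altWord_two_mul_add_one,
    altWord_x_y]

theorem closure_x_y (m : ℕ) : Subgroup.closure {x m, y m} = ⊤ := by
  rw [← PresentedGroup.closure_range_of (relators m)]
  congr 1
  ext g
  simp [x, y, Fin.exists_fin_two, eq_comm]

/-- A pair of matrices satisfying the defining relation gives a representation of `H m`. -/
theorem exists_rep {s : ℕ} (A B : SpecialLinearGroup (Fin 2) ℂ)
    (hAB : (A * B) ^ s * A = B * (A * B) ^ s) :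
    ∃ ρ : Rep (H (2 * s + 1)), ρ (x _) = A ∧ ρ (y _) = B := by
  have hrel : ∀ r ∈ relators (2 * s + 1), FreeGroup.lift ![A, B] r = 1 := by
    rintro r rfl
    rw [map_mul, map_inv, mul_inv_eq_one, map_altWord, map_altWord]
    simpa [altWord_two_mul_add_one, mul_pow_mul_eq_mul_mul_pow] using hAB
  exact ⟨PresentedGroup.toGroup hrel, by simp [x], by simp [y]⟩

/-! ### Trace identities in `SL(2)` -/

section SL2

variable {R : Type*} [CommRing R] (A B : SpecialLinearGroup (Fin 2) R)

theorem coe_inv_eq_trace_smul_sub :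
    ((A⁻¹ : SpecialLinearGroup (Fin 2) R) : Matrix (Fin 2) (Fin 2) R) =
      (A : Matrix (Fin 2) (Fin 2) R).trace • 1 - A := by
  rw [Matrix.SpecialLinearGroup.coe_inv, adjugate_fin_two]
  ext i j
  fin_cases i <;> fin_cases j <;> simp [trace_fin_two]

theorem coe_mul_self :
    (A : Matrix (Fin 2) (Fin 2) R) * A = (A : Matrix (Fin 2) (Fin 2) R).trace • A.1 - 1 := by
  have hA : (A : Matrix (Fin 2) (Fin 2) R) *
      ((A⁻¹ : SpecialLinearGroup (Fin 2) R) : Matrix (Fin 2) (Fin 2) R) = 1 := by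
    rw [← Matrix.SpecialLinearGroup.coe_mul, mul_inv_cancel, Matrix.SpecialLinearGroup.coe_one]
  rw [coe_inv_eq_trace_smul_sub, mul_sub, mul_smul_comm, mul_one] at hA
  rw [← hA]
  abel

/-- Multiply `(AB)⁻¹ = tr(AB) - AB` on the right by `A`; the left side collapses to `B⁻¹ = tr B -
B`. -/
theorem coe_mul_mul_self :
    (A : Matrix (Fin 2) (Fin 2) R) * B * A =
      (A.1 * B.1).trace • A.1 - (B.1.trace • 1 - B.1) := by
  have h := congrArg (· * A.1) (coe_inv_eq_trace_smul_sub (A * B))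
  simp only [_root_.mul_inv_rev, ← Matrix.SpecialLinearGroup.coe_mul, inv_mul_cancel_right, sub_mul,
    smul_mul_assoc, one_mul] at h
  rw [coe_inv_eq_trace_smul_sub] at h
  simp only [Matrix.SpecialLinearGroup.coe_mul] at h
  rw [h]
  abel

/-- The Cayley–Hamilton theorem, polarized. -/
theorem mul_comm_fin_two (M N : Matrix (Fin 2) (Fin 2) R) :
    N * M = M.trace • N + N.trace • M + ((M * N).trace - M.trace * N.trace) • 1 - M * N := by
  ext i j
  fin_cases i <;> fin_cases j <;>
    simp [trace_fin_two, Matrix.mul_apply, Fin.sum_univ_two] <;> ring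

/-- Cayley–Hamilton is the Chebyshev recurrence. Integer indices cover `n = 0`, through `S_{-1} = 0`
and `S_{-2} = -1`. -/
theorem coe_pow_eq (n : ℕ) :
    (A : Matrix (Fin 2) (Fin 2) R) ^ n =
      (Chebyshev.S R (n - 1)).eval A.1.trace • A.1 -
        (Chebyshev.S R (n - 2)).eval A.1.trace • 1 := by
  induction n with
  | zero => simp
  | succ n ih =>
    have hS := congrArg (Polynomial.eval A.1.trace) (Chebyshev.S_add_two R ((n : ℤ) - 2))
    rw [show (n : ℤ) - 2 + 2 = n by ring, show (n : ℤ) - 2 + 1 = n - 1 by ring] at hS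
    simp only [eval_sub, eval_mul, eval_X] at hS
    rw [pow_succ, ih, sub_mul, smul_mul_assoc, coe_mul_self, Nat.cast_succ,
      show (n : ℤ) + 1 - 1 = n by ring, show (n : ℤ) + 1 - 2 = n - 1 by ring, hS]
    simp only [smul_mul_assoc, one_mul]
    module

/-- For matrices with the same trace the defining relation of the torus knot group becomes a
polynomial condition. -/
theorem pow_mul_sub_mul_pow (hAB : A.1.trace = B.1.trace) (s : ℕ) :
    (A.1 * B.1) ^ s * A.1 - B.1 * (A.1 * B.1) ^ s =
      ((Chebyshev.S R s).eval (A.1 * B.1).trace -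
        (Chebyshev.S R (s - 1)).eval (A.1 * B.1).trace) • (A.1 - B.1) := by
  have hS := congrArg (Polynomial.eval (A.1 * B.1).trace) (Chebyshev.S_add_two R ((s : ℤ) - 2))
  rw [show (s : ℤ) - 2 + 2 = s by ring, show (s : ℤ) - 2 + 1 = s - 1 by ring] at hS
  simp only [eval_sub, eval_mul, eval_X] at hS
  have hpow := coe_pow_eq (A * B) s
  rw [Matrix.SpecialLinearGroup.coe_mul] at hpow
  have hBAB := coe_mul_mul_self B A
  rw [trace_mul_comm B.1 A.1, hAB] at hBAB
  have hABA := coe_mul_mul_self A B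
  rw [hpow, hS, sub_mul, mul_sub, smul_mul_assoc, mul_smul_comm, hABA, ← mul_assoc, hBAB]
  simp only [smul_mul_assoc, mul_smul_comm, one_mul, mul_one]
  module

end SL2

/-! ### The trace ring of a two-generator group -/

section TraceRing

variable {G : Type*} [Group G]

theorem coe_eq_combination_of_mem_closure {a b : G} {S : Subring (Rep G → ℂ)}
    (ha : τ a ∈ S) (hb : τ b ∈ S) (hab : τ (a * b) ∈ S) {g : G}
    (hg : g ∈ Subgroup.closure {a, b}) :
    ∃ c₀ ∈ S, ∃ c₁ ∈ S, ∃ c₂ ∈ S, ∃ c₃ ∈ S, ∀ ρ : Rep G,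
      (ρ g).1 = c₀ ρ • 1 + c₁ ρ • (ρ a).1 + c₂ ρ • (ρ b).1 + c₃ ρ • ((ρ a).1 * (ρ b).1) := by
  have mul_a : ∀ g : G, (∃ c₀ ∈ S, ∃ c₁ ∈ S, ∃ c₂ ∈ S, ∃ c₃ ∈ S, ∀ ρ : Rep G,
      (ρ g).1 = c₀ ρ • 1 + c₁ ρ • (ρ a).1 + c₂ ρ • (ρ b).1 + c₃ ρ • ((ρ a).1 * (ρ b).1)) →
      ∃ c₀ ∈ S, ∃ c₁ ∈ S, ∃ c₂ ∈ S, ∃ c₃ ∈ S, ∀ ρ : Rep G,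
      (ρ g).1 * (ρ a).1 =
        c₀ ρ • 1 + c₁ ρ • (ρ a).1 + c₂ ρ • (ρ b).1 + c₃ ρ • ((ρ a).1 * (ρ b).1) := by
    rintro g ⟨c₀, h₀, c₁, h₁, c₂, h₂, c₃, h₃, hc⟩
    -- Read off from the expansions of `a·a`, `b·a` and `ab·a` in the basis `1, a, b, ab`.
    refine ⟨-c₁ + c₂ * (τ (a * b) - τ a * τ b) - c₃ * τ b, ?_,
      c₀ + c₁ * τ a + c₂ * τ b + c₃ * τ (a * b), ?_, c₂ * τ a + c₃, ?_, -c₂, ?_, fun ρ => ?_⟩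
    · exact sub_mem (add_mem (neg_mem h₁) (mul_mem h₂ (sub_mem hab (mul_mem ha hb))))
        (mul_mem h₃ hb)
    · exact add_mem (add_mem (add_mem h₀ (mul_mem h₁ ha)) (mul_mem h₂ hb)) (mul_mem h₃ hab)
    · exact add_mem (mul_mem h₂ ha) h₃
    · exact neg_mem h₂
    · rw [hc, add_mul, add_mul, add_mul]
      simp only [smul_mul_assoc, one_mul]
      rw [coe_mul_self, coe_mul_mul_self, mul_comm_fin_two (ρ a).1 (ρ b).1]
      simp only [τ, Pi.add_apply, Pi.sub_apply, Pi.mul_apply, Pi.neg_apply, map_mul,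
        Matrix.SpecialLinearGroup.coe_mul]
      module
  have mul_b : ∀ g : G, (∃ c₀ ∈ S, ∃ c₁ ∈ S, ∃ c₂ ∈ S, ∃ c₃ ∈ S, ∀ ρ : Rep G,
      (ρ g).1 = c₀ ρ • 1 + c₁ ρ • (ρ a).1 + c₂ ρ • (ρ b).1 + c₃ ρ • ((ρ a).1 * (ρ b).1)) →
      ∃ c₀ ∈ S, ∃ c₁ ∈ S, ∃ c₂ ∈ S, ∃ c₃ ∈ S, ∀ ρ : Rep G,
      (ρ g).1 * (ρ b).1 =
        c₀ ρ • 1 + c₁ ρ • (ρ a).1 + c₂ ρ • (ρ b).1 + c₃ ρ • ((ρ a).1 * (ρ b).1) := by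
    rintro g ⟨c₀, h₀, c₁, h₁, c₂, h₂, c₃, h₃, hc⟩
    refine ⟨-c₂, neg_mem h₂, -c₃, neg_mem h₃, c₀ + c₂ * τ b, add_mem h₀ (mul_mem h₂ hb),
      c₁ + c₃ * τ b, add_mem h₁ (mul_mem h₃ hb), fun ρ => ?_⟩
    rw [hc, add_mul, add_mul, add_mul]
    simp only [smul_mul_assoc, one_mul]
    rw [mul_assoc, coe_mul_self, mul_sub, mul_smul_comm, mul_one]
    simp only [τ, Pi.add_apply, Pi.mul_apply, Pi.neg_apply]
    module
  -- right multiplication by `c⁻¹ = τ c - c`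
  have mul_inv : ∀ c g : G, τ c ∈ S →
      (∃ c₀ ∈ S, ∃ c₁ ∈ S, ∃ c₂ ∈ S, ∃ c₃ ∈ S, ∀ ρ : Rep G,
      (ρ g).1 = c₀ ρ • 1 + c₁ ρ • (ρ a).1 + c₂ ρ • (ρ b).1 + c₃ ρ • ((ρ a).1 * (ρ b).1)) →
      (∃ c₀ ∈ S, ∃ c₁ ∈ S, ∃ c₂ ∈ S, ∃ c₃ ∈ S, ∀ ρ : Rep G,
      (ρ g).1 * (ρ c).1 =
        c₀ ρ • 1 + c₁ ρ • (ρ a).1 + c₂ ρ • (ρ b).1 + c₃ ρ • ((ρ a).1 * (ρ b).1)) →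
      ∃ c₀ ∈ S, ∃ c₁ ∈ S, ∃ c₂ ∈ S, ∃ c₃ ∈ S, ∀ ρ : Rep G,
      (ρ (g * c⁻¹)).1 =
        c₀ ρ • 1 + c₁ ρ • (ρ a).1 + c₂ ρ • (ρ b).1 + c₃ ρ • ((ρ a).1 * (ρ b).1) := by
    rintro c g hτ ⟨c₀, h₀, c₁, h₁, c₂, h₂, c₃, h₃, hc⟩ ⟨d₀, k₀, d₁, k₁, d₂, k₂, d₃, k₃, hd⟩
    refine ⟨τ c * c₀ - d₀, sub_mem (mul_mem hτ h₀) k₀, τ c * c₁ - d₁, sub_mem (mul_mem hτ h₁) k₁,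
      τ c * c₂ - d₂, sub_mem (mul_mem hτ h₂) k₂, τ c * c₃ - d₃, sub_mem (mul_mem hτ h₃) k₃,
      fun ρ => ?_⟩
    rw [map_mul, map_inv, Matrix.SpecialLinearGroup.coe_mul, coe_inv_eq_trace_smul_sub, mul_sub, hd,
      mul_smul_comm, mul_one, hc]
    simp only [τ, Pi.sub_apply, Pi.mul_apply]
    module
  induction hg using Subgroup.closure_induction_right with
  | one => exact ⟨1, one_mem _, 0, zero_mem _, 0, zero_mem _, 0, zero_mem _, fun ρ => by simp⟩
  | mul_right g _ c hc ih =>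
    simp only [map_mul, Matrix.SpecialLinearGroup.coe_mul]
    rcases hc with rfl | rfl
    exacts [mul_a g ih, mul_b g ih]
  | mul_inv_cancel g _ c hc ih =>
    rcases hc with rfl | rfl
    exacts [mul_inv _ g ha ih (mul_a g ih), mul_inv _ g hb ih (mul_b g ih)]

theorem τ_mem_of_mem_closure {a b : G} {S : Subring (Rep G → ℂ)}
    (ha : τ a ∈ S) (hb : τ b ∈ S) (hab : τ (a * b) ∈ S) {g : G}
    (hg : g ∈ Subgroup.closure {a, b}) : τ g ∈ S := by
  obtain ⟨c₀, h₀, c₁, h₁, c₂, h₂, c₃, h₃, hc⟩ := coe_eq_combination_of_mem_closure ha hb hab hg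
  have hg' : τ g = c₀ * 2 + c₁ * τ a + c₂ * τ b + c₃ * τ (a * b) := by
    funext ρ
    simp [τ, hc]
  rw [hg']
  exact add_mem (add_mem (add_mem (mul_mem h₀ (ofNat_mem _ 2)) (mul_mem h₁ ha)) (mul_mem h₂ hb))
    (mul_mem h₃ hab)

theorem generatesTraceRing_of_closure_eq_top {a b : G} (htop : Subgroup.closure {a, b} = ⊤)
    {ν : ℕ} {γ : Fin ν → G}
    (ha : τ a ∈ Subring.closure (Set.range fun i => τ (γ i)))
    (hb : τ b ∈ Subring.closure (Set.range fun i => τ (γ i)))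
    (hab : τ (a * b) ∈ Subring.closure (Set.range fun i => τ (γ i))) :
    GeneratesTraceRing γ := by
  refine le_antisymm (Subring.closure_mono ?_) (Subring.closure_le.2 ?_)
  · rintro _ ⟨i, rfl⟩
    exact ⟨γ i, rfl⟩
  · rintro _ ⟨g, rfl⟩
    exact τ_mem_of_mem_closure ha hb hab (htop ▸ Subgroup.mem_top g)

end TraceRing

/-! ### The polynomials `p` and `f` -/

/-- Fails for `p 0 = 1`, since `S_0 - S_{-2} = 2`; hence the shift. -/
theorem p_succ_eq (n : ℕ) : p (n + 1) = Chebyshev.S ℂ (n + 1) - Chebyshev.S ℂ (n - 1) := by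
  induction n using Nat.strong_induction_on with
  | _ n ih =>
    match n with
    | 0 => simp [p]
    | 1 => norm_num [p, Chebyshev.S_two]; ring
    | n + 2 =>
      have h₁ := Chebyshev.S_add_two ℂ ((n : ℤ) + 1)
      have h₂ := Chebyshev.S_add_two ℂ ((n : ℤ) - 1)
      rw [p, ih (n + 1) (by omega), ih n (by omega)]
      push_cast
      ring_nf at h₁ h₂ ⊢
      rw [h₁, h₂]
      ring

theorem p_add_three (n : ℕ) : p (n + 3) = X * p (n + 2) - p (n + 1) := rfl

theorem eval_pZ (v : Fin 2 → ℂ) (s : ℕ) : MvPolynomial.eval v (pZ s) = (p s).eval (v 1) := by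
  rw [pZ, ← MvPolynomial.coe_aeval_eq_eval, RingHom.coe_coe, ← Polynomial.aeval_algHom_apply]
  simp

/-- As `α` has period 2, the terms `i ≥ 3` of `f (s + 2)` form the sum in `f s`; the final `pZ s` is
`pZ s * h - pZ s * (h - 1)`. -/
theorem f_add_two (s : ℕ) : f (s + 2) = f s + pZ (s + 2) * (h - 1) - pZ (s + 1) * k + pZ s := by
  have hα : ∀ i, α (i + 2) = α i := fun i => by simp [α, Nat.even_add]
  rw [f, f, ← Finset.Ico_add_one_right_eq_Icc, ← Finset.Ico_add_one_right_eq_Icc,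
    Finset.sum_Ico_eq_sum_range, Finset.sum_Ico_eq_sum_range, Nat.add_sub_cancel,
    Nat.add_sub_cancel, Finset.sum_range_succ', Finset.sum_range_succ']
  have hsum : ∑ i ∈ Finset.range s,
      (-1 : MvPolynomial (Fin 2) ℂ) ^ (1 + (i + 1 + 1)) * pZ (s + 2 - (1 + (i + 1 + 1))) *
        α (1 + (i + 1 + 1)) =
      ∑ i ∈ Finset.range s, (-1) ^ (1 + i) * pZ (s - (1 + i)) * α (1 + i) := by
    refine Finset.sum_congr rfl fun i _ => ?_
    rw [show 1 + (i + 1 + 1) = 1 + i + 2 by ring, hα, Nat.add_sub_add_right, pow_add]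
    ring
  rw [hsum]
  simp [α]
  ring

theorem eval_f_succ (v : Fin 2 → ℂ) (n : ℕ) :
    MvPolynomial.eval v (f (n + 1)) =
      ((Chebyshev.S ℂ (n + 1)).eval (v 1) - (Chebyshev.S ℂ n).eval (v 1)) *
        (v 0 ^ 2 - v 1 - 2) := by
  induction n using Nat.strong_induction_on with
  | _ n ih =>
    match n with
    | 0 =>
      simp [f, α, eval_pZ, p, h, k]
      ring
    | 1 =>
      have h0 : f 0 = h - 1 := by simp [f, pZ, p]
      rw [f_add_two, h0]
      norm_num [eval_pZ, p, h, k, Chebyshev.S_two]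
      ring
    | n + 2 =>
      have hp := congrArg (Polynomial.eval (v 1)) (p_add_three n)
      have h₃ := congrArg (Polynomial.eval (v 1)) (p_succ_eq (n + 2))
      have h₂ := congrArg (Polynomial.eval (v 1)) (p_succ_eq (n + 1))
      rw [show n + 2 + 1 = n + 1 + 2 by ring, f_add_two]
      simp only [map_add, map_sub, map_mul, eval_pZ, ih n (by omega), h, k, map_pow,
        MvPolynomial.eval_X, map_one, map_ofNat]
      simp only [eval_sub, eval_mul, eval_X] at hp h₂ h₃
      push_cast at h₂ h₃ ⊢
      ring_nf at hp h₂ h₃ ⊢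
      -- Since `k - Z = h - 2`, the recurrence for `p` turns the increment of `f` into `(p_{n+3} -
      -- p_{n+2}) (h - 2)`.
      linear_combination (v 0 ^ 2 - v 1 - 2) * (h₃ - h₂) + hp

/-! ### The character variety -/

theorem τ_y_eq_τ_x (s : ℕ) : τ (y (2 * s + 1)) = τ (x (2 * s + 1)) := by
  funext ρ
  have hy : y (2 * s + 1) = (x (2 * s + 1) * y (2 * s + 1)) ^ s * x (2 * s + 1) *
      ((x (2 * s + 1) * y (2 * s + 1)) ^ s)⁻¹ := by
    rw [xy_pow_mul_x, mul_inv_cancel_right]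
  simp only [τ]
  conv_lhs => rw [hy, map_mul, map_mul, map_inv, Matrix.SpecialLinearGroup.coe_mul, trace_mul_comm,
    ← Matrix.SpecialLinearGroup.coe_mul, inv_mul_cancel_left]

theorem exists_specialLinearGroup_traces (t z : ℂ) :
    ∃ A B : SpecialLinearGroup (Fin 2) ℂ,
      A.1.trace = t ∧ B.1.trace = t ∧ (A.1 * B.1).trace = z := by
  obtain ⟨a, ha⟩ := IsAlgClosed.exists_eval₂_eq_zero (RingHom.id ℂ) (X ^ 2 - C t * X + 1) (by
    have : (X ^ 2 - C t * X + 1 : ℂ[X]).degree = 2 := by compute_degree!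
    rw [this]; decide)
  simp only [eval₂_id, eval_add, eval_sub, eval_pow, eval_X, eval_mul, eval_C, eval_one] at ha
  have hdet : a * (t - a) = 1 := by linear_combination -ha
  -- Both matrices have eigenvalues `a` and `t - a`; the lower left entry of `B` enters `tr AB`
  -- linearly and is solved for.
  refine ⟨⟨!![a, 1; 0, t - a], by simp [det_fin_two, hdet]⟩,
    ⟨!![a, 0; z - a ^ 2 - (t - a) ^ 2, t - a], by simp [det_fin_two, hdet]⟩, ?_, ?_, ?_⟩
  · simp [trace_fin_two]
  · simp [trace_fin_two]
  · simp [trace_fin_two]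
    ring

theorem exists_rep_iff {s : ℕ} (hs : 0 < s) (v : Fin 2 → ℂ) :
    (∃ ρ : Rep (H (2 * s + 1)), τ (x _) ρ = v 0 ∧ τ (x _ * y _) ρ = v 1) ↔
      MvPolynomial.eval v (f s) = 0 := by
  obtain ⟨n, rfl⟩ := Nat.exists_eq_succ_of_ne_zero hs.ne'
  rw [Nat.succ_eq_add_one, eval_f_succ, mul_eq_zero]
  constructor
  · rintro ⟨ρ, hx, hxy⟩
    have hyx := congrFun (τ_y_eq_τ_x (n + 1)) ρ
    have hrel := congrArg Subtype.val (congrArg ρ (xy_pow_mul_x (n + 1)))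
    simp only [τ, map_mul, Matrix.SpecialLinearGroup.coe_mul, map_pow, Matrix.SpecialLinearGroup.coe_pow]
      at hx hxy hyx hrel
    have hsmul := pow_mul_sub_mul_pow _ _ hyx.symm (n + 1)
    rw [hrel, sub_self, eq_comm, smul_eq_zero, hxy, sub_eq_zero (a := (ρ _).1)] at hsmul
    refine hsmul.imp (fun h => by simpa using h) fun h => ?_
    rw [← h, coe_mul_self, trace_sub, trace_smul, hx] at hxy
    simp at hxy
    linear_combination hxy
  · intro hv
    have hAB : ∃ A B : SpecialLinearGroup (Fin 2) ℂ, A.1.trace = v 0 ∧ (A.1 * B.1).trace = v 1 ∧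
        (A * B) ^ (n + 1) * A = B * (A * B) ^ (n + 1) := by
      rcases hv with hv | hv
      · obtain ⟨A, B, hA, hB, hz⟩ := exists_specialLinearGroup_traces (v 0) (v 1)
        refine ⟨A, B, hA, hz, Subtype.ext ?_⟩
        have hsmul := pow_mul_sub_mul_pow A B (hA.trans hB.symm) (n + 1)
        rw [hz] at hsmul
        push_cast at hsmul
        rw [add_sub_cancel_right, hv, zero_smul, sub_eq_zero] at hsmul
        simpa using hsmul
      -- On the second factor take `B = A`: the relation is trivial and `tr A² = t² - 2`.
      · obtain ⟨A, -, hA, -⟩ := exists_specialLinearGroup_traces (v 0) 0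
        refine ⟨A, A, hA, ?_, ((Commute.refl A).mul_left (Commute.refl A)).pow_left _⟩
        rw [coe_mul_self, trace_sub, trace_smul, hA]
        simp
        linear_combination hv
    obtain ⟨A, B, hA, hz, hrel⟩ := hAB
    obtain ⟨ρ, hx, hy⟩ := exists_rep A B hrel
    exact ⟨ρ, by rw [τ, hx, hA], by rw [τ, map_mul, hx, hy, Matrix.SpecialLinearGroup.coe_mul, hz]⟩

end TorusKnot

open TorusKnot in
theorem mainTheorem3 (m : ℕ) (hm : 1 < m) (hodd : Odd m) :
    (TorusKnot.GeneratesTraceRing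
        ![TorusKnot.x m, TorusKnot.y m, TorusKnot.x m * TorusKnot.y m] ∧
      TorusKnot.characterVariety
          ![TorusKnot.x m, TorusKnot.y m, TorusKnot.x m * TorusKnot.y m] =
        {v : Fin 3 → ℂ | v 1 = v 0 ∧
          MvPolynomial.eval ![v 0, v 2] (TorusKnot.f ((m - 1) / 2)) = 0}) ∧
    (TorusKnot.GeneratesTraceRing ![TorusKnot.x m, TorusKnot.x m * TorusKnot.y m] ∧
      TorusKnot.characterVariety ![TorusKnot.x m, TorusKnot.x m * TorusKnot.y m] =
        {v : Fin 2 → ℂ | MvPolynomial.eval v (TorusKnot.f ((m - 1) / 2)) = 0}) := by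
  obtain ⟨s, rfl⟩ := hodd
  have hs : 0 < s := by omega
  rw [show (2 * s + 1 - 1) / 2 = s by omega]
  refine ⟨⟨generatesTraceRing_of_closure_eq_top (closure_x_y _) (Subring.subset_closure ⟨0, rfl⟩)
      (Subring.subset_closure ⟨1, rfl⟩) (Subring.subset_closure ⟨2, rfl⟩), ?_⟩,
    generatesTraceRing_of_closure_eq_top (closure_x_y _) (Subring.subset_closure ⟨0, rfl⟩)
      (τ_y_eq_τ_x s ▸ Subring.subset_closure ⟨0, rfl⟩) (Subring.subset_closure ⟨1, rfl⟩), ?_⟩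
  · ext v
    rw [Set.mem_ofPred_eq, ← exists_rep_iff hs]
    constructor
    · rintro ⟨ρ, rfl⟩
      exact ⟨congrFun (τ_y_eq_τ_x s) ρ, ρ, rfl, rfl⟩
    · rintro ⟨hv, ρ, hx, hxy⟩
      refine ⟨ρ, funext fun i => ?_⟩
      fin_cases i
      exacts [hx, (congrFun (τ_y_eq_τ_x s) ρ).trans (hx.trans hv.symm), hxy]
  · ext v
    rw [Set.mem_ofPred_eq, ← exists_rep_iff hs]
    constructor
    · rintro ⟨ρ, rfl⟩
      exact ⟨ρ, rfl, rfl⟩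
    · rintro ⟨ρ, hx, hxy⟩
      refine ⟨ρ, funext fun i => ?_⟩
      fin_cases i
      exacts [hx, hxy]
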